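/- **Theorem (first linear-programming bound for mixed codes).** Let $S$ be a finite set of integers greater than $1$. There is a function $e\colon\mathbb{N}\to\mathbb{R}$ with $e(n)=o(n)$ as $n\to\infty$, depending only on $S$, such that the following holds for every $n\ge 1$, all $q_1\le q_2\le\dots\le q_n$ with every $q_i\in S$, and every integer $0\le d\le n$. Let $\mathcal{Q}=\prod_{i=1}^n(\mathbb{Z}/q_i\mathbb{Z})$, and put $$\hat q_{\mathtt a}=\frac1n\sum_{i=1}^n q_i,\qquad \check\delta=\frac{1}{\hat q_{\mathtt a}\,n}\sum_{i=1}^d q_i,\qquad \rho=\frac{n}{\hat q_{\mathtt a}}\left((\hat q_{\mathtt a}-1)-(\hat q_{\mathtt a}-2)\check\delta-2\sqrt{(\hat q_{\mathtt a}-1)\,\check\delta\,(1-\check\delta)}\right).$$ If $C\subseteq\mathcal{Q}$ is a code of minimum distance $d$, that is, any two distinct elements of $C$ differ in at least $d$ coordinates, then $$\log|C|\;\le\; n\,\log(\hat q_{\mathtt a})\,H_{\hat q_{\mathtt a}}(\rho/n)+e(n),$$ where $H_q(x)=x\log_q(q-1)-x\log_q x-(1-x)\log_q(1-x)$ is the $q$-ary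 entropy function (with $0\log_q 0=0$) and $\log$ is the natural logarithm. -/

import Mathlib

open Filter Asymptotics

noncomputable section

/-- The space `∏ i, ℤ/q_iℤ` of words of length `n` over the mixed alphabet sizes `q`. -/
abbrev MixedSpace {n : ℕ} (q : Fin n → ℕ) : Type := ∀ i : Fin n, ZMod (q i)

/-- `C` has minimum distance `d`: distinct codewords are at Hamming distance at least `d`. -/
def HasMinDist {n : ℕ} {q : Fin n → ℕ} (C : Finset (MixedSpace q)) (d : ℕ) : Prop :=
  ∀ x ∈ C, ∀ y ∈ C, x ≠ y → d ≤ hammingDist x y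

/-- The arithmetic mean of the alphabet sizes. -/
def arithMean {n : ℕ} (q : Fin n → ℕ) : ℝ := (1 / (n : ℝ)) * ∑ i, (q i : ℝ)

/-- The `q`-ary entropy function, for a real `q > 1`. -/
def mixedEntropy (q x : ℝ) : ℝ :=
  x * Real.logb q (q - 1) - x * Real.logb q x - (1 - x) * Real.logb q (1 - x)

/-- The sum of the first `d` alphabet sizes, divided by the sum of all of them. -/
def deltaCheck {n : ℕ} (q : Fin n → ℕ) (d : ℕ) : ℝ :=
  1 / (arithMean q * n) * ∑ i ∈ Finset.univ.filter (fun i : Fin n => (i : ℕ) < d), (q i : ℝ)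

/-- The radius in the first linear-programming bound. -/
def lpRadius {n : ℕ} (q : Fin n → ℕ) (d : ℕ) : ℝ :=
  (n : ℝ) / arithMean q *
    ((arithMean q - 1) - (arithMean q - 2) * deltaCheck q d
      - 2 * √((arithMean q - 1) * deltaCheck q d * (1 - deltaCheck q d)))

end

/-! This is the Fourier form of Delsarte's method. The operator `∑ i, J_i` has the characters as
eigenvectors, and its eigenvalue at `x` is the total of the `q i` over the zero coordinates of `x`.
As `q` is sorted, the coordinates where two distinct codewords agree have total at most `c₀ = n *
arithMean q * (1 - deltaCheck q d)`. If `f ≥ 0` is supported in `B` and the operator acts on `f` as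
at least `c > c₀`, positivity of the characters gives `|C| (c - c₀) ≤ |B| (∑ q i - c₀)`
(`card_mul_le_of_smul_le_mulVec`, `card_mul_le_card_mul`). Such an `f` exists once some nonnegative
function on `B` has Rayleigh quotient at least `c`: a maximizer of the quotient serves.

The set `B` is a Hamming ball and the trial function is `s ^ hammingNorm x` cut off outside it. Its
square is a product measure, so the weight concentrates, the quotient is nearly a sum of
`fugacityRayleigh (q i - 1) s`, and `log |B|` is nearly at most a sum of `fugacityEntropy (q i - 1)
s`. In the alphabet size the first summand is convex and the second concave, so both sums may be
compared with the mean alphabet. There `exists_fugacity` finds the `s` that reaches `c₀` with the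
entropy of the theorem. Raising `s` by a small `η` creates the gap `c - c₀`; since alphabets are
bounded, the cost is uniformly `o(n)`. -/

open Matrix in
/-- A nonnegative test vector whose Rayleigh quotient for a symmetric nonnegative matrix is at least
`c` can be replaced by one, with support in the same set, on which the matrix acts as at least
multiplication by `c`. -/
theorem exists_nonneg_smul_le_mulVec {V : Type*} [Fintype V] (A : Matrix V V ℝ)
    (hA : A.IsSymm) (hA0 : ∀ u v, 0 ≤ A u v) (B : Finset V) (g : V → ℝ) (hg0 : 0 ≤ g)
    (hgB : ∀ u, u ∉ B → g u = 0) (hg : g ≠ 0) (c : ℝ) (hc : c * (g ⬝ᵥ g) ≤ g ⬝ᵥ (A *ᵥ g)) :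
    ∃ f : V → ℝ, 0 ≤ f ∧ (∀ u, u ∉ B → f u = 0) ∧ f ≠ 0 ∧ ∀ u, c * f u ≤ (A *ᵥ f) u := by
  classical
  have pos_of_ne : ∀ h : V → ℝ, h ≠ 0 → 0 < h ⬝ᵥ h := fun h hh =>
    lt_of_le_of_ne (Finset.sum_nonneg fun i _ => mul_self_nonneg _)
      (fun h0 => hh (dotProduct_self_eq_zero.1 h0.symm))
  let K : Set (V → ℝ) := {f | 0 ≤ f ∧ (∀ u, u ∉ B → f u = 0) ∧ f ⬝ᵥ f = 1}
  have hKc : IsCompact K := by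
    refine IsCompact.of_isClosed_subset (isCompact_Icc (a := (0 : V → ℝ)) (b := 1)) ?_ ?_
    · have h1 : IsClosed {f : V → ℝ | ∀ u, u ∉ B → f u = 0} := by
        simp only [Set.ofPred_forall]
        exact isClosed_iInter fun u => isClosed_iInter fun _ =>
          isClosed_eq (continuous_apply u) continuous_const
      have h2 : IsClosed {f : V → ℝ | f ⬝ᵥ f = 1} :=
        isClosed_eq (by unfold dotProduct; fun_prop) continuous_const
      exact (isClosed_le continuous_const continuous_id).inter (h1.inter h2)
    · rintro f ⟨h0, -, h1⟩
      refine ⟨h0, fun u => ?_⟩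
      have : f u * f u ≤ f ⬝ᵥ f :=
        Finset.single_le_sum (f := fun i => f i * f i) (fun i _ => mul_self_nonneg _)
          (Finset.mem_univ u)
      have h0u := h0 u
      simp only [Pi.zero_apply, Pi.one_apply] at h0u ⊢
      nlinarith
  have hnorm : ∀ h : V → ℝ, 0 ≤ h → (∀ u, u ∉ B → h u = 0) → h ≠ 0 →
      (√(h ⬝ᵥ h))⁻¹ • h ∈ K := by
    intro h h0 hB hne
    have hp := pos_of_ne h hne
    refine ⟨smul_nonneg (by positivity) h0, fun u hu => by simp [hB u hu], ?_⟩
    rw [smul_dotProduct, dotProduct_smul, smul_eq_mul, smul_eq_mul, ← mul_assoc, ← mul_inv,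
      Real.mul_self_sqrt hp.le, inv_mul_cancel₀ hp.ne']
  obtain ⟨f, hfK, hmax⟩ := hKc.exists_isMaxOn ⟨_, hnorm g hg0 hgB hg⟩
    (f := fun f : V → ℝ => f ⬝ᵥ (A *ᵥ f))
    (Continuous.continuousOn (by unfold dotProduct mulVec dotProduct; fun_prop))
  obtain ⟨hf0, hfB, hf1⟩ := hfK
  set l := f ⬝ᵥ (A *ᵥ f) with hl
  have hom : ∀ h : V → ℝ, 0 ≤ h → (∀ u, u ∉ B → h u = 0) →
      h ⬝ᵥ (A *ᵥ h) ≤ l * (h ⬝ᵥ h) := by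
    intro h h0 hB
    by_cases hne : h = 0
    · simp [hne]
    have hp := pos_of_ne h hne
    have := hmax (hnorm h h0 hB hne)
    simp only [Set.mem_ofPred_eq, mulVec_smul] at this
    rw [smul_dotProduct, dotProduct_smul, smul_eq_mul, smul_eq_mul, ← mul_assoc, ← mul_inv,
      Real.mul_self_sqrt hp.le, ← hl, inv_mul_le_iff₀ hp] at this
    linarith
  have hAf0 : ∀ u, 0 ≤ (A *ᵥ f) u := fun u =>
    Finset.sum_nonneg fun v _ => mul_nonneg (hA0 u v) (hf0 v)
  have hl0 : 0 ≤ l := Finset.sum_nonneg fun u _ => mul_nonneg (hf0 u) (hAf0 u)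
  have hcl : c ≤ l := le_of_mul_le_mul_right (hc.trans (hom g hg0 hgB)) (pos_of_ne g hg)
  refine ⟨f, hf0, hfB, fun h => by simp [h] at hf1, fun u => ?_⟩
  have hfu := hf0 u
  simp only [Pi.zero_apply] at hfu
  refine (mul_le_mul_of_nonneg_right hcl hfu).trans ?_
  rcases hfu.eq_or_lt with h0 | hpos
  · rw [← h0, mul_zero]; exact hAf0 u
  -- If the inequality fails at a point with `f u > 0`, lowering `f` there by a small `τ` keeps it
  -- nonnegative and supported in `B` but raises the Rayleigh quotient. The bound `τ * (l + 1) ≤ X`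
  -- makes the first-order gain beat the second-order loss.
  by_contra! hlt
  set X := l * f u - (A *ᵥ f) u with hX
  have hXpos : 0 < X := sub_pos.2 hlt
  obtain ⟨τ, hτ0, hτ1, hτ2⟩ : ∃ τ : ℝ, 0 < τ ∧ τ ≤ f u ∧ τ * (l + 1) ≤ X := by
    refine ⟨min (f u) (X / (l + 1)), lt_min hpos (by positivity), min_le_left _ _, ?_⟩
    rw [← le_div_iff₀ (by positivity)]
    exact min_le_right _ _
  have key := hom (f - τ • Pi.single u 1) (fun v => ?_) (fun v hv => ?_)
  · have e1 : (f - τ • Pi.single u (1 : ℝ)) ⬝ᵥ (A *ᵥ (f - τ • Pi.single u 1))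
        = l - 2 * τ * (A *ᵥ f) u + τ ^ 2 * A u u := by
      have e3 : f ⬝ᵥ (A *ᵥ Pi.single u 1) = (A *ᵥ f) u := by
        rw [dotProduct_mulVec, ← mulVec_transpose, hA.eq, dotProduct_single, mul_one]
      rw [mulVec_sub, mulVec_smul, sub_dotProduct, dotProduct_sub, dotProduct_sub,
        dotProduct_smul, smul_dotProduct, smul_dotProduct, dotProduct_smul, e3]
      simp only [single_dotProduct, mulVec_single, smul_eq_mul, one_mul, ← hl]
      simp
      ring
    have e2 : (f - τ • Pi.single u (1 : ℝ)) ⬝ᵥ (f - τ • Pi.single u 1)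
        = 1 - 2 * τ * f u + τ ^ 2 := by
      rw [sub_dotProduct, dotProduct_sub, dotProduct_sub, hf1,
        dotProduct_smul, smul_dotProduct, smul_dotProduct, dotProduct_smul]
      simp
      ring
    rw [e1, e2] at key
    have hAu := hA0 u u
    have h3 : 2 * X ≤ τ * l := by
      refine le_of_mul_le_mul_left ?_ hτ0
      nlinarith [mul_nonneg (sq_nonneg τ) hAu]
    linarith
  · by_cases h : v = u
    · subst h; simpa using hτ1
    · simpa [h] using hf0 v
  · have : v ≠ u := fun h => by rw [h] at hv; exact hpos.ne' (hfB u hv)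
    simp [this, hfB v hv]

/-! ### Characters and the linear-programming inequality -/

section LinearProgramming

variable {n : ℕ} {q : Fin n → ℕ} [∀ i, NeZero (q i)]

/-- The pairing of the mixed space with itself by characters. -/
noncomputable def mixedChar (x y : MixedSpace q) : ℂ := ∏ i, ZMod.stdAddChar (x i * y i)

theorem mixedChar_comm (x y : MixedSpace q) : mixedChar x y = mixedChar y x := by
  simp only [mixedChar, mul_comm]

theorem mixedChar_add_right (x y z : MixedSpace q) :
    mixedChar x (y + z) = mixedChar x y * mixedChar x z := by
  simp only [mixedChar, Pi.add_apply, mul_add, AddChar.map_add_eq_mul, Finset.prod_mul_distrib]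

theorem mixedChar_neg_right (x y : MixedSpace q) :
    mixedChar x (-y) = (starRingEnd ℂ) (mixedChar x y) := by
  simp only [mixedChar, Pi.neg_apply, mul_neg, AddChar.map_neg_eq_conj, map_prod]

theorem mixedChar_sub_right (x y z : MixedSpace q) :
    mixedChar x (y - z) = mixedChar x y * (starRingEnd ℂ) (mixedChar x z) := by
  rw [sub_eq_add_neg, mixedChar_add_right, mixedChar_neg_right]

theorem mixedChar_sub_left (x y z : MixedSpace q) :
    mixedChar (y - z) x = mixedChar y x * (starRingEnd ℂ) (mixedChar z x) := by
  rw [mixedChar_comm, mixedChar_sub_right, mixedChar_comm x, mixedChar_comm x]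

theorem mixedChar_zero_left (y : MixedSpace q) : mixedChar 0 y = 1 := by
  simp [mixedChar]

theorem mixedChar_single (x : MixedSpace q) (i : Fin n) (a : ZMod (q i)) :
    mixedChar x (Pi.single i a) = ZMod.stdAddChar (x i * a) := by
  rw [mixedChar, Finset.prod_eq_single i]
  · simp
  · intro j _ hj
    simp [hj]
  · simp

theorem sum_mixedChar_single (x : MixedSpace q) (i : Fin n) :
    ∑ a : ZMod (q i), mixedChar x (Pi.single i a) = if x i = 0 then (q i : ℂ) else 0 := by
  simp_rw [mixedChar_single, mul_comm (x i)]
  rw [AddChar.sum_mulShift _ (ZMod.isPrimitive_stdAddChar _), ZMod.card]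
  split_ifs <;> simp

/-- Delsarte positivity: the difference multiset of a code has nonnegative Fourier transform. -/
theorem sum_sum_mixedChar_sub (C : Finset (MixedSpace q)) (y : MixedSpace q) :
    ∑ c ∈ C, ∑ c' ∈ C, mixedChar (c - c') y = (Complex.normSq (∑ c ∈ C, mixedChar c y) : ℂ) := by
  rw [← Complex.mul_conj, map_sum, Finset.sum_mul_sum]
  simp_rw [mixedChar_sub_left]

/-- The operator `∑ i, J_i`, where `J_i` sums a function over the `i`-th coordinate. -/
noncomputable def coordSumMatrix (q : Fin n → ℕ) [∀ i, NeZero (q i)] :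
    Matrix (MixedSpace q) (MixedSpace q) ℝ :=
  fun u v => ∑ i, ∑ a : ZMod (q i), if u + Pi.single i a = v then 1 else 0

theorem coordSumMatrix_nonneg (u v : MixedSpace q) : 0 ≤ coordSumMatrix q u v :=
  Finset.sum_nonneg fun _ _ => Finset.sum_nonneg fun _ _ => by split_ifs <;> simp

theorem coordSumMatrix_isSymm : (coordSumMatrix q).IsSymm := by
  ext u v
  simp only [Matrix.transpose_apply, coordSumMatrix]
  refine Finset.sum_congr rfl fun i _ => ?_
  rw [← Equiv.sum_comp (Equiv.neg (ZMod (q i)))]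
  refine Finset.sum_congr rfl fun a _ => ?_
  refine if_congr ?_ rfl rfl
  rw [Equiv.neg_apply, Pi.single_neg, ← sub_eq_add_neg, sub_eq_iff_eq_add, eq_comm]

theorem coordSumMatrix_mulVec (f : MixedSpace q → ℝ) (u : MixedSpace q) :
    (coordSumMatrix q).mulVec f u = ∑ i, ∑ a : ZMod (q i), f (u + Pi.single i a) := by
  simp only [Matrix.mulVec, dotProduct, coordSumMatrix, Finset.sum_mul, ite_mul, one_mul, zero_mul]
  rw [Finset.sum_comm]
  refine Finset.sum_congr rfl fun i _ => ?_
  rw [Finset.sum_comm]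
  simp

/-- The characters diagonalize `coordSumMatrix`. -/
theorem sum_coordSumMatrix_mulVec_mul_mixedChar (f : MixedSpace q → ℝ) (x : MixedSpace q) :
    ∑ u, (((coordSumMatrix q).mulVec f u : ℝ) : ℂ) * mixedChar x u =
      ((∑ i, if x i = 0 then (q i : ℝ) else 0 : ℝ) : ℂ) * ∑ u, (f u : ℂ) * mixedChar x u := by
  simp_rw [coordSumMatrix_mulVec]
  push_cast
  simp_rw [Finset.sum_mul]
  rw [Finset.sum_comm]
  refine Finset.sum_congr rfl fun i _ => ?_
  have := sum_mixedChar_single x i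
  rw [← Equiv.sum_comp (Equiv.neg (ZMod (q i)))] at this
  rw [apply_ite Complex.ofReal, Complex.ofReal_natCast, Complex.ofReal_zero, ← this, Finset.sum_comm,
    Finset.sum_mul]
  refine Finset.sum_congr rfl fun a _ => ?_
  rw [← Equiv.sum_comp (Equiv.subRight (Pi.single i a : MixedSpace q)), Finset.mul_sum]
  refine Finset.sum_congr rfl fun u _ => ?_
  simp only [Equiv.subRight_apply, sub_add_cancel, Equiv.neg_apply, Pi.single_neg,
    mixedChar_sub_right, mixedChar_neg_right]
  ring

/-- The linear-programming inequality given by a function on which `coordSumMatrix` acts as at least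
multiplication by `c`. -/
theorem card_mul_le_of_smul_le_mulVec (C : Finset (MixedSpace q)) (hC : C.Nonempty) (c₀ c : ℝ)
    (hcc : c₀ ≤ c)
    (hdist : ∀ x ∈ C, ∀ y ∈ C, x ≠ y → (∑ i, if x i = y i then (q i : ℝ) else 0) ≤ c₀)
    (f : MixedSpace q → ℝ) (hf0 : 0 ≤ f)
    (hf : ∀ u, c * f u ≤ (coordSumMatrix q).mulVec f u) :
    C.card * ((c - c₀) * ∑ u, f u ^ 2) ≤ (∑ u, f u) ^ 2 * ((∑ i, (q i : ℝ)) - c₀) := by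
  set F : MixedSpace q → ℂ := fun x => ∑ u, (f u : ℂ) * mixedChar x u with hF
  set K : MixedSpace q → ℝ := fun x => ∑ i, if x i = 0 then (q i : ℝ) else 0 with hK
  set D : MixedSpace q → ℝ := fun u => (coordSumMatrix q).mulVec f u - c₀ * f u with hD
  have hDf : ∀ u, (c - c₀) * f u ≤ D u := fun u => by
    have := hf u
    simp only [hD]; linarith
  have hKF : ∀ x, ((K x - c₀ : ℝ) : ℂ) * F x = ∑ u, (D u : ℂ) * mixedChar x u := fun x => by
    simp only [hD, Complex.ofReal_sub, sub_mul, Finset.sum_sub_distrib, Complex.ofReal_mul]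
    rw [sum_coordSumMatrix_mulVec_mul_mixedChar]
    simp only [mul_assoc, ← Finset.mul_sum, hF, hK]
  -- One quantity is evaluated twice. On the left the minimum distance makes all terms with `x ≠ y`
  -- nonpositive; on the right all terms are nonnegative, and keeping only `u = v` gives the lower
  -- bound.
  have key : ∑ x ∈ C, ∑ y ∈ C, Complex.normSq (F (x - y)) * (K (x - y) - c₀) =
      ∑ v, ∑ u, f v * D u * Complex.normSq (∑ x ∈ C, mixedChar x (u - v)) := by
    apply Complex.ofReal_injective
    push_cast
    calc ∑ x ∈ C, ∑ y ∈ C, (Complex.normSq (F (x - y)) : ℂ) * ((K (x - y) : ℂ) - c₀)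
        = ∑ x ∈ C, ∑ y ∈ C, ∑ v, ∑ u, (f v : ℂ) * D u * mixedChar (x - y) (u - v) := by
          refine Finset.sum_congr rfl fun x _ => Finset.sum_congr rfl fun y _ => ?_
          have h := hKF (x - y)
          push_cast at h
          rw [← Complex.mul_conj, mul_comm, ← mul_assoc, h, hF, map_sum, Finset.sum_mul_sum,
            Finset.sum_comm]
          refine Finset.sum_congr rfl fun v _ => Finset.sum_congr rfl fun u _ => ?_
          rw [mixedChar_sub_right, map_mul, Complex.conj_ofReal]
          ring
      _ = ∑ v, ∑ u, (f v : ℂ) * D u * ∑ x ∈ C, ∑ y ∈ C, mixedChar (x - y) (u - v) := by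
          simp_rw [Finset.mul_sum]
          rw [← Finset.sum_product', Finset.sum_comm]
          refine Finset.sum_congr rfl fun v _ => ?_
          rw [Finset.sum_comm]
          refine Finset.sum_congr rfl fun u _ => ?_
          rw [Finset.sum_product]
      _ = _ := by simp_rw [sum_sum_mixedChar_sub]
  have hlow : (c - c₀) * (∑ u, f u ^ 2) * (C.card : ℝ) ^ 2 ≤
      ∑ v, ∑ u, f v * D u * Complex.normSq (∑ x ∈ C, mixedChar x (u - v)) := by
    rw [Finset.mul_sum, Finset.sum_mul]
    refine Finset.sum_le_sum fun v _ => ?_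
    have hv := hf0 v
    have hterm : ∀ u, 0 ≤ f v * D u * Complex.normSq (∑ x ∈ C, mixedChar x (u - v)) := fun u =>
      mul_nonneg (mul_nonneg hv ((mul_nonneg (sub_nonneg.2 hcc) (hf0 u)).trans (hDf u)))
        (Complex.normSq_nonneg _)
    refine le_trans ?_ (Finset.single_le_sum (fun u _ => hterm u) (Finset.mem_univ v))
    have hone : ∑ x ∈ C, mixedChar x (v - v) = (C.card : ℂ) := by
      simp_rw [sub_self, mixedChar_comm _ 0, mixedChar_zero_left]
      simp
    rw [hone, Complex.normSq_natCast, ← pow_two]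
    refine mul_le_mul_of_nonneg_right ?_ (sq_nonneg _)
    calc (c - c₀) * f v ^ 2 = f v * ((c - c₀) * f v) := by ring
      _ ≤ f v * D v := mul_le_mul_of_nonneg_left (hDf v) hv
  have hup : ∑ x ∈ C, ∑ y ∈ C, Complex.normSq (F (x - y)) * (K (x - y) - c₀) ≤
      C.card * ((∑ u, f u) ^ 2 * ((∑ i, (q i : ℝ)) - c₀)) := by
    rw [← nsmul_eq_mul, ← Finset.sum_const]
    refine Finset.sum_le_sum fun x hx => ?_
    rw [← Finset.add_sum_erase _ _ hx]
    have h0 : Complex.normSq (F (x - x)) * (K (x - x) - c₀) =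
        (∑ u, f u) ^ 2 * ((∑ i, (q i : ℝ)) - c₀) := by
      simp only [sub_self, hF, hK, mixedChar_zero_left, mul_one, ← Complex.ofReal_sum,
        Complex.normSq_ofReal, Pi.zero_apply, if_true, ← pow_two]
    rw [h0, add_le_iff_nonpos_right]
    refine Finset.sum_nonpos fun y hy => ?_
    refine mul_nonpos_of_nonneg_of_nonpos (Complex.normSq_nonneg _) (sub_nonpos.2 ?_)
    simpa only [hK, Pi.sub_apply, sub_eq_zero] using
      hdist x hx y (Finset.mem_of_mem_erase hy) (Finset.ne_of_mem_erase hy).symm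
  have hcard : (0 : ℝ) < C.card := by exact_mod_cast hC.card_pos
  refine le_of_mul_le_mul_left ?_ hcard
  rw [key] at hup
  linarith [hlow.trans hup]

/-- The size of a code is bounded by that of a set carrying a test function with large Rayleigh
quotient. -/
theorem card_mul_le_card_mul (C : Finset (MixedSpace q)) (hC : C.Nonempty) (c₀ c : ℝ)
    (hcc : c₀ ≤ c) (hc₀ : c₀ ≤ ∑ i, (q i : ℝ))
    (hdist : ∀ x ∈ C, ∀ y ∈ C, x ≠ y → (∑ i, if x i = y i then (q i : ℝ) else 0) ≤ c₀)
    (B : Finset (MixedSpace q)) (g : MixedSpace q → ℝ) (hg0 : 0 ≤ g)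
    (hgB : ∀ u, u ∉ B → g u = 0) (hg : g ≠ 0)
    (hgc : c * (g ⬝ᵥ g) ≤ g ⬝ᵥ ((coordSumMatrix q).mulVec g)) :
    C.card * (c - c₀) ≤ B.card * ((∑ i, (q i : ℝ)) - c₀) := by
  obtain ⟨f, hf0, hfB, hf, hfc⟩ := exists_nonneg_smul_le_mulVec (coordSumMatrix q)
    coordSumMatrix_isSymm coordSumMatrix_nonneg B g hg0 hgB hg c hgc
  have h := card_mul_le_of_smul_le_mulVec C hC c₀ c hcc hdist f hf0 hfc
  have hpos : 0 < ∑ u, f u ^ 2 := by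
    obtain ⟨u, hu⟩ := Function.ne_iff.1 hf
    exact Finset.sum_pos' (fun _ _ => sq_nonneg _)
      ⟨u, Finset.mem_univ _, lt_of_le_of_ne (sq_nonneg _) (pow_ne_zero 2 hu).symm⟩
  -- Cauchy–Schwarz on the support; this is how the size of `B` enters.
  have hB : (∑ u, f u) ^ 2 ≤ B.card * ∑ u, f u ^ 2 := by
    have h1 : ∑ u, f u = ∑ u ∈ B, f u :=
      (Finset.sum_subset (Finset.subset_univ _) fun u _ hu => hfB u hu).symm
    rw [h1]
    refine sq_sum_le_card_mul_sum_sq.trans (mul_le_mul_of_nonneg_left ?_ (Nat.cast_nonneg _))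
    exact Finset.sum_le_sum_of_subset_of_nonneg (Finset.subset_univ _) fun _ _ _ => sq_nonneg _
  refine le_of_mul_le_mul_right ?_ hpos
  have := mul_le_mul_of_nonneg_right hB (sub_nonneg.2 hc₀)
  linarith

end LinearProgramming

/-! ### The geometric test function and its truncation to a ball -/

section TestFunction

variable {n : ℕ} {q : Fin n → ℕ}

theorem pow_hammingNorm_eq_prod (r : ℝ) (x : MixedSpace q) :
    r ^ hammingNorm x = ∏ i, if x i = 0 then 1 else r := by
  rw [hammingNorm, Finset.prod_ite, Finset.prod_const_one, one_mul, Finset.prod_const]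

theorem hammingNorm_le_add_single (x : MixedSpace q) (i : Fin n) (a : ZMod (q i)) :
    hammingNorm x ≤ hammingNorm (x + Pi.single i a) + 1 := by
  have h1 := hammingDist_triangle x (x + Pi.single i a) 0
  have h2 : hammingDist x (x + Pi.single i a) ≤ 1 := by
    rw [hammingDist, ← Finset.card_singleton i]
    refine Finset.card_le_card fun j hj => ?_
    by_contra h
    rw [Finset.mem_singleton] at h
    simp [h] at hj
  simp only [hammingDist_zero_right] at h1
  omega

variable [∀ i, NeZero (q i)]

theorem sum_ite_eq_zero (m : ℕ) [NeZero m] (r : ℝ) :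
    (∑ a : ZMod m, if a = 0 then 1 else r) = 1 + ((m : ℝ) - 1) * r := by
  have h : ∀ a : ZMod m, (if a = 0 then 1 else r) = r + if a = 0 then 1 - r else 0 := fun a => by
    split_ifs <;> ring
  simp_rw [h, Finset.sum_add_distrib, Finset.sum_ite_eq', Finset.sum_const, Finset.card_univ,
    ZMod.card, nsmul_eq_mul]
  simp
  ring

theorem sum_pow_hammingNorm (q : Fin n → ℕ) [∀ i, NeZero (q i)] (r : ℝ) :
    ∑ x : MixedSpace q, r ^ hammingNorm x = ∏ i, (1 + ((q i : ℝ) - 1) * r) := by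
  simp_rw [pow_hammingNorm_eq_prod, ← sum_ite_eq_zero]
  rw [Fintype.prod_sum]

-- Everything factors over coordinates; inserting `J_i` only replaces the `i`-th factor, the sum of
-- squares of the letter weights, by the square of their sum.
open Matrix in
theorem dotProduct_coordSumMatrix_pow_hammingNorm (q : Fin n → ℕ) [∀ i, NeZero (q i)] (s : ℝ)
    (hs : ∀ i, 0 < 1 + ((q i : ℝ) - 1) * s ^ 2) :
    (fun x : MixedSpace q => s ^ hammingNorm x) ⬝ᵥ
        (coordSumMatrix q *ᵥ fun x => s ^ hammingNorm x) =
      (∑ i, (1 + ((q i : ℝ) - 1) * s) ^ 2 / (1 + ((q i : ℝ) - 1) * s ^ 2)) *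
        ∏ i, (1 + ((q i : ℝ) - 1) * s ^ 2) := by
  simp only [dotProduct, coordSumMatrix_mulVec, Finset.mul_sum, Finset.sum_mul]
  rw [Finset.sum_comm]
  refine Finset.sum_congr rfl fun i _ => ?_
  rw [Finset.sum_comm]
  set φ : ∀ j, ZMod (q j) → ℝ := fun j b => if b = 0 then 1 else s with hφ
  have hφ1 : ∀ j, ∑ b, φ j b = 1 + ((q j : ℝ) - 1) * s := fun j => sum_ite_eq_zero _ _
  have hφ2 : ∀ j, ∑ b, φ j b * φ j b = 1 + ((q j : ℝ) - 1) * s ^ 2 := fun j => by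
    rw [← sum_ite_eq_zero]
    refine Finset.sum_congr rfl fun b _ => ?_
    simp only [hφ]
    split_ifs <;> ring
  have hone : ∀ a : ZMod (q i),
      ∑ x : MixedSpace q, s ^ hammingNorm x * s ^ hammingNorm (x + Pi.single i a) =
        (∑ b, φ i b * φ i (b + a)) *
          ((∏ j, (1 + ((q j : ℝ) - 1) * s ^ 2)) / (1 + ((q i : ℝ) - 1) * s ^ 2)) := by
    intro a
    simp_rw [pow_hammingNorm_eq_prod, ← Finset.prod_mul_distrib, Pi.add_apply]
    rw [← Fintype.prod_sum (fun j (b : ZMod (q j)) => (if b = 0 then (1 : ℝ) else s) *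
      if b + (Pi.single i a : MixedSpace q) j = 0 then 1 else s),
      ← Finset.mul_prod_erase _ _ (Finset.mem_univ i),
      ← Finset.mul_prod_erase _ (fun j => 1 + ((q j : ℝ) - 1) * s ^ 2) (Finset.mem_univ i),
      mul_div_cancel_left₀ _ (hs i).ne']
    congr 1
    · simp [hφ]
    · refine Finset.prod_congr rfl fun j hj => ?_
      rw [← hφ2]
      simp [hφ, Finset.ne_of_mem_erase hj]
  simp_rw [hone]
  rw [← Finset.sum_mul, Finset.sum_comm]
  have : ∀ b, ∑ a, φ i b * φ i (b + a) = φ i b * (1 + ((q i : ℝ) - 1) * s) := fun b => by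
    rw [← Finset.mul_sum, ← hφ1]
    exact congrArg _ (Equiv.sum_comp (Equiv.addLeft b) (φ i))
  simp_rw [this]
  rw [← Finset.sum_mul, hφ1]
  ring

-- Changing one letter lowers the weight by at most one, at the cost of a factor `1 / s`. This crude
-- bound is enough because it is only applied to the exponentially small tail.
open Matrix in
theorem coordSumMatrix_mulVec_pow_hammingNorm_le (s : ℝ) (hs0 : 0 < s) (hs1 : s ≤ 1)
    (x : MixedSpace q) :
    (coordSumMatrix q *ᵥ fun x => s ^ hammingNorm x) x ≤
      ((∑ i, (q i : ℝ)) / s) * s ^ hammingNorm x := by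
  rw [coordSumMatrix_mulVec, Finset.sum_div, Finset.sum_mul]
  refine Finset.sum_le_sum fun i _ => ?_
  calc ∑ a : ZMod (q i), s ^ hammingNorm (x + Pi.single i a)
      ≤ ∑ a : ZMod (q i), s⁻¹ * s ^ hammingNorm x := by
        refine Finset.sum_le_sum fun a _ => ?_
        rw [← div_eq_inv_mul, le_div_iff₀ hs0, ← pow_succ]
        exact pow_le_pow_of_le_one hs0.le hs1 (hammingNorm_le_add_single x i a)
    _ = q i / s * s ^ hammingNorm x := by
        rw [Finset.sum_const, Finset.card_univ, ZMod.card, nsmul_eq_mul]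
        ring

/-- A Chernoff bound for the weight of a random word. -/
theorem sum_pow_hammingNorm_tail_le (q : Fin n → ℕ) [∀ i, NeZero (q i)] (r ε : ℝ) (hr : 0 ≤ r)
    (hε0 : 0 ≤ ε) (hε : ε ≤ 2) :
    (∑ x : MixedSpace q, if (hammingNorm x : ℝ) ≤
        (∑ i, ((q i : ℝ) - 1) * r / (1 + ((q i : ℝ) - 1) * r)) + ε * n then 0
      else r ^ hammingNorm x) ≤
      (∏ i, (1 + ((q i : ℝ) - 1) * r)) * Real.exp (-(n * ε ^ 2 / 4)) := by
  set m := ∑ i, ((q i : ℝ) - 1) * r / (1 + ((q i : ℝ) - 1) * r) with hm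
  have ht : ∀ i, 0 ≤ ((q i : ℝ) - 1) * r := fun i => by
    have : (1 : ℝ) ≤ q i := by exact_mod_cast NeZero.one_le
    exact mul_nonneg (by linarith) hr
  -- This minimizes the final exponent `n * (η ^ 2 - ε * η)`; `ε ≤ 2` keeps `η ≤ 1`, as the
  -- quadratic bound on `Real.exp` requires.
  set η := ε / 2 with hη
  have hη0 : 0 ≤ η := by positivity
  have hexp : Real.exp η - 1 ≤ η + η ^ 2 := by
    have := abs_le.1 (Real.abs_exp_sub_one_sub_id_le (x := η) (by rw [abs_of_nonneg hη0]; linarith))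
    linarith [this.2]
  calc (∑ x : MixedSpace q, if (hammingNorm x : ℝ) ≤ m + ε * n then 0 else r ^ hammingNorm x)
      ≤ ∑ x : MixedSpace q, Real.exp (-(η * (m + ε * n))) * (r * Real.exp η) ^ hammingNorm x := by
        refine Finset.sum_le_sum fun x _ => ?_
        rw [mul_pow, ← Real.exp_nat_mul, mul_left_comm, ← Real.exp_add]
        split_ifs with h
        · positivity
        · refine le_mul_of_one_le_right (by positivity) (Real.one_le_exp ?_)
          nlinarith
    _ = Real.exp (-(η * (m + ε * n))) * ∏ i, (1 + ((q i : ℝ) - 1) * (r * Real.exp η)) := by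
        rw [← Finset.mul_sum, sum_pow_hammingNorm]
    _ ≤ Real.exp (-(η * (m + ε * n))) * ∏ i, ((1 + ((q i : ℝ) - 1) * r) *
          Real.exp (((q i : ℝ) - 1) * r / (1 + ((q i : ℝ) - 1) * r) * η + η ^ 2)) := by
        refine mul_le_mul_of_nonneg_left (Finset.prod_le_prod (fun i _ => ?_) fun i _ => ?_)
          (Real.exp_pos _).le
        · have := mul_nonneg (ht i) (Real.exp_pos η).le
          linarith
        · have hti := ht i
          set τ := ((q i : ℝ) - 1) * r with hτ
          have hp1 : τ / (1 + τ) ≤ 1 := by rw [div_le_one (by linarith)]; linarith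
          have hp0 : 0 ≤ τ / (1 + τ) := by positivity
          calc 1 + ((q i : ℝ) - 1) * (r * Real.exp η)
              = (1 + τ) * (τ / (1 + τ) * (Real.exp η - 1) + 1) := by
                field_simp
                rw [hτ]; ring
            _ ≤ (1 + τ) * Real.exp (τ / (1 + τ) * η + η ^ 2) := by
                refine mul_le_mul_of_nonneg_left ((Real.add_one_le_exp _).trans
                  (Real.exp_le_exp.2 ?_)) (by linarith)
                nlinarith [mul_le_mul_of_nonneg_left hexp hp0,
                  mul_le_mul_of_nonneg_right hp1 (sq_nonneg η)]
    _ = _ := by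
        rw [Finset.prod_mul_distrib, ← Real.exp_sum, mul_left_comm, ← Real.exp_add,
          Finset.sum_add_distrib, ← Finset.sum_mul, ← hm, Finset.sum_const, Finset.card_univ,
          Fintype.card_fin, nsmul_eq_mul, hη]
        congr 2
        ring

/-- Every word of the ball has mass at least `s ^ (2 * W)` in a measure whose total mass is a
product. When `W` is the mean weight, the bound is the sum of the letter entropies. -/
theorem log_card_hammingBall_le (q : Fin n → ℕ) [∀ i, NeZero (q i)] (s W : ℝ) (hs0 : 0 < s)
    (hs1 : s ≤ 1) (hW : 0 ≤ W) :
    Real.log (Finset.univ.filter fun x : MixedSpace q => (hammingNorm x : ℝ) ≤ W).card ≤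
      (∑ i, Real.log (1 + ((q i : ℝ) - 1) * s ^ 2)) + W * (2 * -Real.log s) := by
  set B := Finset.univ.filter fun x : MixedSpace q => (hammingNorm x : ℝ) ≤ W with hB
  have hpos : (0 : ℝ) < B.card := by
    have : (0 : MixedSpace q) ∈ B := by simpa [hB] using hW
    exact_mod_cast Finset.card_pos.2 ⟨_, this⟩
  have hq : ∀ i, 1 + ((q i : ℝ) - 1) * s ^ 2 ≠ 0 := fun i => by
    have : (1 : ℝ) ≤ q i := by exact_mod_cast NeZero.one_le
    have := mul_nonneg (sub_nonneg.2 this) (sq_nonneg s)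
    linarith
  have key : (B.card : ℝ) * (s ^ 2) ^ W ≤ ∏ i, (1 + ((q i : ℝ) - 1) * s ^ 2) := by
    rw [← sum_pow_hammingNorm, ← nsmul_eq_mul, ← Finset.sum_const]
    refine (Finset.sum_le_sum fun x hx => ?_).trans (Finset.sum_le_sum_of_subset_of_nonneg
      (Finset.subset_univ B) fun _ _ _ => by positivity)
    rw [← Real.rpow_natCast (s ^ 2)]
    exact Real.rpow_le_rpow_of_exponent_ge (by positivity) (by nlinarith)
      (by simpa [hB] using hx)
  have := Real.log_le_log (by positivity) key
  rw [Real.log_mul hpos.ne' (by positivity), Real.log_rpow (by positivity), Real.log_pow,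
    Real.log_prod (fun i _ => hq i)] at this
  push_cast at this
  linarith

open Matrix in
/-- The linear-programming bound with a truncated geometric test function. -/
theorem card_mul_le_card_hammingBall_mul (C : Finset (MixedSpace q)) (hC : C.Nonempty) (c₀ c : ℝ)
    (hcc : c₀ ≤ c) (hc₀ : c₀ ≤ ∑ i, (q i : ℝ)) (hc : 0 ≤ c)
    (hdist : ∀ x ∈ C, ∀ y ∈ C, x ≠ y → (∑ i, if x i = y i then (q i : ℝ) else 0) ≤ c₀)
    (s ε : ℝ) (hs0 : 0 < s) (hs1 : s ≤ 1) (hε0 : 0 ≤ ε) (hε : ε ≤ 2)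
    (hcs : c ≤ (∑ i, (1 + ((q i : ℝ) - 1) * s) ^ 2 / (1 + ((q i : ℝ) - 1) * s ^ 2)) -
      2 * ((∑ i, (q i : ℝ)) / s) * Real.exp (-(n * ε ^ 2 / 4))) :
    C.card * (c - c₀) ≤ (Finset.univ.filter fun x : MixedSpace q => (hammingNorm x : ℝ) ≤
        (∑ i, ((q i : ℝ) - 1) * s ^ 2 / (1 + ((q i : ℝ) - 1) * s ^ 2)) + ε * n).card *
      ((∑ i, (q i : ℝ)) - c₀) := by
  have hq : ∀ i, 0 ≤ ((q i : ℝ) - 1) * s ^ 2 := fun i => by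
    have : (1 : ℝ) ≤ q i := by exact_mod_cast NeZero.one_le
    exact mul_nonneg (sub_nonneg.2 this) (sq_nonneg s)
  set W := (∑ i, ((q i : ℝ) - 1) * s ^ 2 / (1 + ((q i : ℝ) - 1) * s ^ 2)) + ε * n with hW
  have hW0 : 0 ≤ W := add_nonneg (Finset.sum_nonneg fun i _ =>
    div_nonneg (hq i) (by linarith [hq i])) (by positivity)
  set Z := ∏ i, (1 + ((q i : ℝ) - 1) * s ^ 2) with hZ
  have hZ0 : 0 ≤ Z := Finset.prod_nonneg fun i _ => by linarith [hq i]
  set h : MixedSpace q → ℝ := fun x => s ^ hammingNorm x with hh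
  set g : MixedSpace q → ℝ := fun x => if (hammingNorm x : ℝ) ≤ W then s ^ hammingNorm x else 0
    with hg
  set k : MixedSpace q → ℝ := fun x => if (hammingNorm x : ℝ) ≤ W then 0 else s ^ hammingNorm x
    with hk
  have hk0 : 0 ≤ k := fun x => by
    simp only [hk, Pi.zero_apply]; split_ifs <;> positivity
  have hgk : g = h - k := by
    ext x
    simp only [hg, hh, hk, Pi.sub_apply]
    split_ifs <;> simp
  have hhA := dotProduct_coordSumMatrix_pow_hammingNorm q s fun i => by linarith [hq i]
  rw [← hZ, ← hh] at hhA
  refine card_mul_le_card_mul C hC c₀ c hcc hc₀ hdist _ g (fun x => ?_) (fun x hx => ?_)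
    (fun h0 => ?_) ?_
  · simp only [hg, Pi.zero_apply]; split_ifs <;> positivity
  · simp only [Finset.mem_filter, Finset.mem_univ, true_and] at hx
    simp [hg, hx]
  · have := congrFun h0 0
    simp [hg, hW0] at this
  · have hgg : g ⬝ᵥ g ≤ Z := by
      rw [hZ, ← sum_pow_hammingNorm]
      refine Finset.sum_le_sum fun x _ => ?_
      simp only [hg]
      split_ifs
      · rw [← pow_mul, ← pow_add, two_mul]
      · rw [mul_zero]; positivity
    have hkA : k ⬝ᵥ (coordSumMatrix q *ᵥ h) ≤
        ((∑ i, (q i : ℝ)) / s) * (Z * Real.exp (-(n * ε ^ 2 / 4))) := by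
      refine le_trans ?_ (mul_le_mul_of_nonneg_left
        (sum_pow_hammingNorm_tail_le q (s ^ 2) ε (sq_nonneg s) hε0 hε) (by positivity))
      rw [Finset.mul_sum]
      refine Finset.sum_le_sum fun x _ => ?_
      refine (mul_le_mul_of_nonneg_left
        (coordSumMatrix_mulVec_pow_hammingNorm_le s hs0 hs1 x) (hk0 x)).trans_eq ?_
      simp only [hk, ← hW]
      split_ifs
      · simp
      · rw [← pow_mul]; ring
    have hkk : 0 ≤ k ⬝ᵥ (coordSumMatrix q *ᵥ k) :=
      Finset.sum_nonneg fun x _ => mul_nonneg (hk0 x)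
        (Finset.sum_nonneg fun y _ => mul_nonneg (coordSumMatrix_nonneg x y) (hk0 y))
    have hsymm : h ⬝ᵥ (coordSumMatrix q *ᵥ k) = k ⬝ᵥ (coordSumMatrix q *ᵥ h) := by
      rw [dotProduct_mulVec, ← mulVec_transpose, coordSumMatrix_isSymm.eq, dotProduct_comm]
    -- The last term is nonnegative and is dropped, so truncation costs at most twice the cross
    -- term, which the tail bound controls.
    have hexpand : g ⬝ᵥ (coordSumMatrix q *ᵥ g) = h ⬝ᵥ (coordSumMatrix q *ᵥ h)
        - 2 * (k ⬝ᵥ (coordSumMatrix q *ᵥ h)) + k ⬝ᵥ (coordSumMatrix q *ᵥ k) := by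
      rw [hgk, mulVec_sub, sub_dotProduct, dotProduct_sub, dotProduct_sub, hsymm]
      ring
    rw [hexpand, hhA]
    have h1 := mul_le_mul_of_nonneg_left hgg hc
    have h2 := mul_le_mul_of_nonneg_right hcs hZ0
    linarith

end TestFunction

/-! ### One-letter entropy and Rayleigh quotient -/

section Fugacity

/-- The entropy of the distribution on an alphabet of size `t + 1` giving each nonzero letter `s ^ 2`
times the mass of zero. -/
noncomputable def fugacityEntropy (t s : ℝ) : ℝ :=
  Real.log (1 + t * s ^ 2) + 2 * (t * s / (1 + t * s ^ 2)) * Real.negMulLog s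

/-- The Rayleigh quotient of the all-ones matrix of size `t + 1` at the vector with first entry `1`
and the others `s`. -/
noncomputable def fugacityRayleigh (t s : ℝ) : ℝ := (1 + t * s) ^ 2 / (1 + t * s ^ 2)

/-- Concavity of `t / (1 + t * r)` in `t`, the common source of concavity of the entropy and
convexity of the quotient. -/
theorem div_one_add_mul_le_tangent {r a t : ℝ} (hr : 0 ≤ r) (ha : 0 ≤ a) (ht : 0 ≤ t) :
    t / (1 + t * r) ≤ a / (1 + a * r) + (t - a) / (1 + a * r) ^ 2 := by
  have h1 : 0 < 1 + t * r := by positivity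
  have h2 : 0 < 1 + a * r := by positivity
  have : a / (1 + a * r) + (t - a) / (1 + a * r) ^ 2 - t / (1 + t * r) =
      (t - a) ^ 2 * r / ((1 + a * r) ^ 2 * (1 + t * r)) := by
    field_simp
    ring
  have h3 : 0 ≤ (t - a) ^ 2 * r / ((1 + a * r) ^ 2 * (1 + t * r)) := by positivity
  linarith

theorem exists_fugacityEntropy_le_tangent {s a : ℝ} (hs0 : 0 ≤ s) (hs1 : s ≤ 1) (ha : 0 ≤ a) :
    ∃ k, ∀ t, 0 ≤ t → fugacityEntropy t s ≤ fugacityEntropy a s + k * (t - a) := by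
  refine ⟨s ^ 2 / (1 + a * s ^ 2) + 2 * s * Real.negMulLog s / (1 + a * s ^ 2) ^ 2,
    fun t ht => ?_⟩
  have h1 : 0 < 1 + t * s ^ 2 := by positivity
  have h2 : 0 < 1 + a * s ^ 2 := by positivity
  have hlog : Real.log (1 + t * s ^ 2) ≤
      Real.log (1 + a * s ^ 2) + s ^ 2 / (1 + a * s ^ 2) * (t - a) := by
    have := Real.log_le_sub_one_of_pos (div_pos h1 h2)
    rw [Real.log_div h1.ne' h2.ne'] at this
    have e : (1 + t * s ^ 2) / (1 + a * s ^ 2) - 1 = s ^ 2 / (1 + a * s ^ 2) * (t - a) := by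
      field_simp
      ring
    linarith
  have hn : 0 ≤ 2 * s * Real.negMulLog s :=
    mul_nonneg (by positivity) (Real.negMulLog_nonneg hs0 hs1)
  have := mul_le_mul_of_nonneg_right (div_one_add_mul_le_tangent (sq_nonneg s) ha ht) hn
  simp only [fugacityEntropy]
  have e1 : ∀ u : ℝ, 2 * (u * s / (1 + u * s ^ 2)) * Real.negMulLog s =
      u / (1 + u * s ^ 2) * (2 * s * Real.negMulLog s) := fun u => by ring
  rw [e1, e1, add_mul]
  have e2 : 2 * s * Real.negMulLog s / (1 + a * s ^ 2) ^ 2 * (t - a) =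
      (t - a) / (1 + a * s ^ 2) ^ 2 * (2 * s * Real.negMulLog s) := by ring
  rw [e2]
  linarith

theorem fugacityRayleigh_eq {t s : ℝ} (ht : 0 ≤ t) :
    fugacityRayleigh t s = 1 + t - t / (1 + t * s ^ 2) * (1 - s) ^ 2 := by
  have h1 : 0 < 1 + t * s ^ 2 := by positivity
  simp only [fugacityRayleigh]
  field_simp
  ring

theorem exists_tangent_le_fugacityRayleigh (s : ℝ) {a : ℝ} (ha : 0 ≤ a) :
    ∃ k, ∀ t, 0 ≤ t → fugacityRayleigh a s + k * (t - a) ≤ fugacityRayleigh t s := by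
  refine ⟨1 - (1 - s) ^ 2 / (1 + a * s ^ 2) ^ 2, fun t ht => ?_⟩
  rw [fugacityRayleigh_eq ha, fugacityRayleigh_eq ht]
  have := mul_le_mul_of_nonneg_right (div_one_add_mul_le_tangent (sq_nonneg s) ha ht)
    (sq_nonneg (1 - s))
  have e : (1 - (1 - s) ^ 2 / (1 + a * s ^ 2) ^ 2) * (t - a) =
    t - a - (t - a) / (1 + a * s ^ 2) ^ 2 * (1 - s) ^ 2 := by ring
  rw [e]
  linarith

theorem sum_fugacityEntropy_le {n : ℕ} (t : Fin n → ℝ) (ht : ∀ i, 0 ≤ t i) {s a : ℝ}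
    (hs0 : 0 ≤ s) (hs1 : s ≤ 1) (ha : 0 ≤ a) (hsum : ∑ i, t i = n * a) :
    ∑ i, fugacityEntropy (t i) s ≤ n * fugacityEntropy a s := by
  obtain ⟨k, hk⟩ := exists_fugacityEntropy_le_tangent hs0 hs1 ha
  refine (Finset.sum_le_sum fun i _ => hk (t i) (ht i)).trans_eq ?_
  rw [Finset.sum_add_distrib, ← Finset.mul_sum, Finset.sum_sub_distrib, hsum]
  simp

theorem le_sum_fugacityRayleigh {n : ℕ} (t : Fin n → ℝ) (ht : ∀ i, 0 ≤ t i) (s : ℝ) {a : ℝ}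
    (ha : 0 ≤ a) (hsum : ∑ i, t i = n * a) :
    n * fugacityRayleigh a s ≤ ∑ i, fugacityRayleigh (t i) s := by
  obtain ⟨k, hk⟩ := exists_tangent_le_fugacityRayleigh s ha
  refine le_trans (le_of_eq ?_) (Finset.sum_le_sum fun i _ => hk (t i) (ht i))
  rw [Finset.sum_add_distrib, ← Finset.mul_sum, Finset.sum_sub_distrib, hsum]
  simp

/-- In `fugacityRayleigh_eq` the subtracted fraction is at least `1 / 2` and decreases in `s`, while
`(1 - s) ^ 2` drops by at least `η ^ 2`. -/
theorem fugacityRayleigh_add_le {t s η : ℝ} (ht : 1 ≤ t) (hs : 0 ≤ s) (hη : 0 ≤ η)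
    (hsη : s + η ≤ 1) :
    fugacityRayleigh t s + η ^ 2 / 2 ≤ fugacityRayleigh t (s + η) := by
  have ht0 : 0 ≤ t := by linarith
  rw [fugacityRayleigh_eq ht0, fugacityRayleigh_eq ht0]
  have h1 : 0 < 1 + t * s ^ 2 := by positivity
  have h3 : t / (1 + t * (s + η) ^ 2) ≤ t / (1 + t * s ^ 2) := by
    refine div_le_div_of_nonneg_left ht0 h1 ?_
    have : s ^ 2 ≤ (s + η) ^ 2 := by nlinarith
    nlinarith
  have h4 : 1 / 2 ≤ t / (1 + t * s ^ 2) := by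
    rw [div_le_div_iff₀ two_pos h1]
    have : s ^ 2 ≤ 1 := by nlinarith
    nlinarith
  have h5 : η ^ 2 ≤ (1 - s) ^ 2 - (1 - (s + η)) ^ 2 := by nlinarith
  have h6 := mul_le_mul_of_nonneg_right h3 (sq_nonneg (1 - (s + η)))
  have h7 := mul_le_mul h4 h5 (sq_nonneg η) (by positivity)
  linarith

theorem log_mul_mixedEntropy {q : ℝ} (hq : 1 < q) (x : ℝ) :
    Real.log q * mixedEntropy q x =
      x * Real.log (q - 1) + Real.negMulLog x + Real.negMulLog (1 - x) := by
  have : Real.log q ≠ 0 := (Real.log_pos hq).ne'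
  simp only [mixedEntropy, Real.logb, Real.negMulLog]
  field_simp
  ring

/-- The nonzero letters are equally likely with total mass `t * s ^ 2 / (1 + t * s ^ 2)`, and the
entropy depends on that mass alone. -/
theorem fugacityEntropy_eq {t s : ℝ} (ht : 0 < t) (hs : 0 ≤ s) :
    fugacityEntropy t s =
      Real.log (1 + t) * mixedEntropy (1 + t) (t * s ^ 2 / (1 + t * s ^ 2)) := by
  rw [log_mul_mixedEntropy (by linarith)]
  have h1 : 0 < 1 + t * s ^ 2 := by positivity
  have e : 1 - t * s ^ 2 / (1 + t * s ^ 2) = (1 + t * s ^ 2)⁻¹ := by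
    field_simp
    ring
  rw [e, add_sub_cancel_left]
  rcases hs.eq_or_lt with rfl | hs
  · simp [fugacityEntropy]
  · simp only [fugacityEntropy, Real.negMulLog, Real.log_inv]
    rw [Real.log_div (by positivity) h1.ne', Real.log_mul ht.ne' (by positivity), Real.log_pow]
    field_simp
    push_cast
    ring

theorem log_mul_mixedEntropy_nonneg {q x : ℝ} (hq : 2 ≤ q) (hx0 : 0 ≤ x) (hx1 : x ≤ 1) :
    0 ≤ Real.log q * mixedEntropy q x := by
  rw [log_mul_mixedEntropy (by linarith)]
  have h1 := mul_nonneg hx0 (Real.log_nonneg (x := q - 1) (by linarith))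
  have h2 := Real.negMulLog_nonneg hx0 hx1
  have h3 := Real.negMulLog_nonneg (x := 1 - x) (by linarith) (by linarith)
  linarith

/-- The fugacity attaining the relative distance `δ` in the linear-programming bound. -/
theorem exists_fugacity {t δ : ℝ} (ht : 1 ≤ t) (hδ0 : 0 ≤ δ) (hδ1 : δ ≤ 1) :
    ∃ s, 0 ≤ s ∧ s ≤ 1 ∧ (1 + t) * (1 - δ) ≤ fugacityRayleigh t s ∧
      fugacityEntropy t s ≤ Real.log (1 + t) * mixedEntropy (1 + t)
        ((t - (t - 1) * δ - 2 * √(t * δ * (1 - δ))) / (1 + t)) := by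
  set a := √(1 - δ) with ha
  set b := √δ with hb
  set r := √t with hr
  have ha2 : a ^ 2 = 1 - δ := Real.sq_sqrt (by linarith)
  have hb2 : b ^ 2 = δ := Real.sq_sqrt hδ0
  have hr2 : r ^ 2 = t := Real.sq_sqrt (by linarith)
  have ha0 : 0 ≤ a := Real.sqrt_nonneg _
  have hb0 : 0 ≤ b := Real.sqrt_nonneg _
  have hr0 : 0 < r := Real.sqrt_pos.2 (by linarith)
  have hab : a ^ 2 + b ^ 2 = 1 := by rw [ha2, hb2]; ring
  have hroot : √(t * δ * (1 - δ)) = r * b * a := by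
    rw [Real.sqrt_mul (by nlinarith), Real.sqrt_mul (by linarith)]
  have hp : t - (t - 1) * δ - 2 * √(t * δ * (1 - δ)) = (r * a - b) ^ 2 := by
    rw [hroot, ← hr2, ← hb2]
    linear_combination (-r ^ 2) * hab
  rw [hp]
  by_cases hcase : b ≤ r * a
  · have hD : 0 < a + r * b := by
      rcases ha0.eq_or_lt with h | h
      · have : b ^ 2 = 1 := by rw [← hab, ← h]; ring
        have : 0 < b := lt_of_le_of_ne hb0 fun h0 => by rw [← h0] at this; norm_num at this
        positivity
      · positivity
    -- This `s` makes the nonzero letters carry mass `(r * a - b) ^ 2 / (1 + t)`, exactly the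
    -- argument of the entropy. The identity is `(a + r * b) ^ 2 + (r * a - b) ^ 2 = (1 + r ^ 2) *
    -- (a ^ 2 + b ^ 2)`.
    have h1s : 1 + t * ((r * a - b) / (r * (a + r * b))) ^ 2 = (1 + t) / (a + r * b) ^ 2 := by
      rw [← hr2]
      field_simp
      linear_combination (1 + r ^ 2) * hab
    refine ⟨(r * a - b) / (r * (a + r * b)), div_nonneg (by linarith) (by positivity), ?_, ?_, ?_⟩
    · rw [div_le_one (by positivity)]
      nlinarith [mul_nonneg hb0 (sq_nonneg r)]
    · rw [fugacityRayleigh_eq (by linarith), h1s]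
      refine le_of_eq ?_
      have e : 1 - (r * a - b) / (r * (a + r * b)) = b * (1 + t) / (r * (a + r * b)) := by
        rw [← hr2]
        field_simp
        ring
      have : 0 < 1 + t := by linarith
      have e2 : t / ((1 + t) / (a + r * b) ^ 2) * (b * (1 + t) / (r * (a + r * b))) ^ 2 =
          (1 + t) * b ^ 2 := by
        field_simp
        rw [hr2]
      rw [e, e2, hb2]
      ring
    · rw [fugacityEntropy_eq (by linarith) (div_nonneg (by linarith) (by positivity)), h1s]
      refine le_of_eq ?_
      congr 2
      have : 0 < 1 + t := by linarith
      field_simp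
      rw [hr2]
  · push Not at hcase
    -- Plotkin range: `(1 + t) * (1 - δ) ≤ 1`, so the point mass at zero already suffices, with
    -- entropy `0`.
    refine ⟨0, le_rfl, zero_le_one, ?_, ?_⟩
    · simp only [fugacityRayleigh]
      have : (r * a) ^ 2 ≤ b ^ 2 := by gcongr
      rw [mul_pow, hr2, ha2, hb2] at this
      norm_num
      linarith
    · have : fugacityEntropy t 0 = 0 := by simp [fugacityEntropy]
      rw [this]
      refine log_mul_mixedEntropy_nonneg (by linarith) (by positivity) ?_
      rw [div_le_one (by linarith)]
      nlinarith [sq_nonneg (a + r * b)]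

/-- Uniform continuity on a compact rectangle, including `s = 0`. The bound `M` on alphabets makes
`η` independent of the code. -/
theorem exists_forall_abs_fugacityEntropy_sub_le (M : ℝ) {ε : ℝ} (hε : 0 < ε) :
    ∃ η, 0 < η ∧ η < 1 ∧ ∀ t s s', 0 ≤ t → t ≤ M → 0 ≤ s → s ≤ 1 → 0 ≤ s' → s' ≤ 1 →
      |s - s'| ≤ η → |fugacityEntropy t s - fugacityEntropy t s'| ≤ ε := by
  have hc : ContinuousOn (fun p : ℝ × ℝ => fugacityEntropy p.1 p.2)
      (Set.Icc 0 M ×ˢ Set.Icc 0 1) := by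
    have hne : ∀ p ∈ (Set.Icc 0 M ×ˢ Set.Icc 0 1 : Set (ℝ × ℝ)), 1 + p.1 * p.2 ^ 2 ≠ 0 := by
      rintro p ⟨hp, -⟩
      have := mul_nonneg hp.1 (sq_nonneg p.2)
      linarith
    unfold fugacityEntropy
    refine ContinuousOn.add (ContinuousOn.log (by fun_prop) hne) (ContinuousOn.mul
      (continuousOn_const.mul (ContinuousOn.div (by fun_prop) (by fun_prop) hne))
      (Real.continuous_negMulLog.comp continuous_snd).continuousOn)
  obtain ⟨δ, hδ, h⟩ := Metric.uniformContinuousOn_iff_le.1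
    ((isCompact_Icc.prod isCompact_Icc).uniformContinuousOn_of_continuous hc) ε hε
  refine ⟨min δ (1 / 2), by positivity, (min_le_right _ _).trans_lt (by norm_num), ?_⟩
  intro t s s' ht0 htM hs0 hs1 hs'0 hs'1 hss
  have := h (t, s) ⟨⟨ht0, htM⟩, hs0, hs1⟩ (t, s') ⟨⟨ht0, htM⟩, hs'0, hs'1⟩ (by
    rw [Prod.dist_eq, dist_self, Real.dist_eq, max_le_iff]
    exact ⟨hδ.le, hss.trans (min_le_left _ _)⟩)
  rwa [Real.dist_eq] at this

end Fugacity

/-! ### Assembling the bound for codes -/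

section MainBound

variable {n : ℕ} {q : Fin n → ℕ}

theorem sum_filter_lt_le_sum_of_le_card (hq : Monotone q) {d : ℕ} (hd : d ≤ n)
    (T : Finset (Fin n)) (hT : d ≤ T.card) :
    ∑ i ∈ Finset.univ.filter (fun i : Fin n => (i : ℕ) < d), (q i : ℝ) ≤ ∑ i ∈ T, (q i : ℝ) := by
  set I := Finset.univ.filter (fun i : Fin n => (i : ℕ) < d) with hI
  have hIc : I.card = d := by
    rw [hI, Fin.card_filter_val_lt, min_eq_right hd]
  -- A threshold for exchanging `I \ T` with `T \ I`. If `d = n` there is no entry at index `d`, and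
  -- any upper bound will do.
  obtain ⟨c, hc0, hc1, hc2⟩ : ∃ c : ℝ, 0 ≤ c ∧ (∀ i ∈ I, (q i : ℝ) ≤ c) ∧
      ∀ i, i ∉ I → c ≤ (q i : ℝ) := by
    rcases hd.lt_or_eq with h | h
    · refine ⟨q ⟨d, h⟩, Nat.cast_nonneg _, fun i hi => ?_, fun i hi => ?_⟩
      · have : (i : ℕ) < d := by simpa [hI] using hi
        exact_mod_cast hq (show i ≤ ⟨d, h⟩ from this.le)
      · have : d ≤ (i : ℕ) := by simpa [hI] using hi
        exact_mod_cast hq (show ⟨d, h⟩ ≤ i from this)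
    · refine ⟨∑ i, (q i : ℝ), Finset.sum_nonneg fun _ _ => Nat.cast_nonneg _, fun i _ =>
        Finset.single_le_sum (f := fun i => (q i : ℝ)) (fun _ _ => Nat.cast_nonneg _)
          (Finset.mem_univ i), fun i hi => absurd ?_ hi⟩
      simp [hI, h]
  rw [← Finset.sum_inter_add_sum_sdiff I T, ← Finset.sum_inter_add_sum_sdiff T I,
    Finset.inter_comm T I]
  refine add_le_add_right ?_ _
  have h1 : ((I \ T).card : ℝ) ≤ (T \ I).card := by
    have h2 := Finset.card_inter_add_card_sdiff I T
    have h3 := Finset.card_inter_add_card_sdiff T I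
    rw [Finset.inter_comm T I] at h3
    exact_mod_cast (by omega)
  calc ∑ i ∈ I \ T, (q i : ℝ) ≤ (I \ T).card * c := by
        rw [← nsmul_eq_mul]
        exact Finset.sum_le_card_nsmul _ _ _ fun i hi => hc1 i (Finset.mem_sdiff.1 hi).1
    _ ≤ (T \ I).card * c := mul_le_mul_of_nonneg_right h1 hc0
    _ ≤ _ := by
        rw [← nsmul_eq_mul]
        exact Finset.card_nsmul_le_sum _ _ _ fun i hi => hc2 i (Finset.mem_sdiff.1 hi).2

theorem sum_eq_mul_arithMean (hn : 0 < n) : ∑ i, (q i : ℝ) = n * arithMean q := by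
  have : (n : ℝ) ≠ 0 := by exact_mod_cast hn.ne'
  rw [arithMean]
  field_simp

theorem two_le_arithMean (hn : 0 < n) (hq : ∀ i, 2 ≤ q i) : 2 ≤ arithMean q := by
  have hn' : (0 : ℝ) < n := by exact_mod_cast hn
  refine le_of_mul_le_mul_left ?_ hn'
  rw [← sum_eq_mul_arithMean hn]
  have := Finset.card_nsmul_le_sum Finset.univ (fun i => (q i : ℝ)) 2 fun i _ => by
    exact_mod_cast hq i
  simpa using this

theorem arithMean_le (hn : 0 < n) {M : ℝ} (hq : ∀ i, (q i : ℝ) ≤ M) : arithMean q ≤ M := by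
  have hn' : (0 : ℝ) < n := by exact_mod_cast hn
  refine le_of_mul_le_mul_left ?_ hn'
  rw [← sum_eq_mul_arithMean hn]
  simpa using Finset.sum_le_card_nsmul Finset.univ (fun i => (q i : ℝ)) M fun i _ => hq i

theorem sum_sub_one_eq (hn : 0 < n) : ∑ i, ((q i : ℝ) - 1) = n * (arithMean q - 1) := by
  rw [Finset.sum_sub_distrib, sum_eq_mul_arithMean hn]
  simp
  ring

theorem deltaCheck_mul (hn : 0 < n) (hq : ∀ i, 2 ≤ q i) (d : ℕ) :
    n * arithMean q * deltaCheck q d =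
      ∑ i ∈ Finset.univ.filter (fun i : Fin n => (i : ℕ) < d), (q i : ℝ) := by
  have hn' : (n : ℝ) ≠ 0 := by exact_mod_cast hn.ne'
  have := two_le_arithMean hn hq
  have : arithMean q ≠ 0 := by linarith
  rw [deltaCheck]
  field_simp

theorem deltaCheck_nonneg (hn : 0 < n) (hq : ∀ i, 2 ≤ q i) (d : ℕ) : 0 ≤ deltaCheck q d := by
  have := two_le_arithMean hn hq
  rw [deltaCheck]
  exact mul_nonneg (by positivity) (Finset.sum_nonneg fun _ _ => Nat.cast_nonneg _)

theorem deltaCheck_le_one (hn : 0 < n) (hq : ∀ i, 2 ≤ q i) (d : ℕ) : deltaCheck q d ≤ 1 := by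
  have hn' : (0 : ℝ) < n := by exact_mod_cast hn
  have := two_le_arithMean hn hq
  have hpos : 0 < n * arithMean q := by positivity
  refine le_of_mul_le_mul_left ?_ hpos
  rw [deltaCheck_mul hn hq, mul_one, ← sum_eq_mul_arithMean hn]
  exact Finset.sum_le_sum_of_subset_of_nonneg (Finset.filter_subset _ _)
    fun _ _ _ => Nat.cast_nonneg _

theorem exists_fugacity_lpRadius (hn : 0 < n) (hq : ∀ i, 2 ≤ q i) (d : ℕ) :
    ∃ s, 0 ≤ s ∧ s ≤ 1 ∧
      arithMean q * (1 - deltaCheck q d) ≤ fugacityRayleigh (arithMean q - 1) s ∧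
      fugacityEntropy (arithMean q - 1) s ≤
        Real.log (arithMean q) * mixedEntropy (arithMean q) (lpRadius q d / n) := by
  have hn' : (n : ℝ) ≠ 0 := by exact_mod_cast hn.ne'
  have hm := two_le_arithMean hn hq
  have hm0 : arithMean q ≠ 0 := by linarith
  obtain ⟨s, hs0, hs1, h1, h2⟩ := exists_fugacity (t := arithMean q - 1) (by linarith)
    (deltaCheck_nonneg hn hq d) (deltaCheck_le_one hn hq d)
  refine ⟨s, hs0, hs1, ?_, ?_⟩
  · rwa [add_sub_cancel] at h1
  · rw [add_sub_cancel] at h2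
    convert h2 using 3
    rw [lpRadius]
    field_simp
    ring

theorem fugacityEntropy_nonneg {t s : ℝ} (ht : 0 ≤ t) (hs0 : 0 ≤ s) (hs1 : s ≤ 1) :
    0 ≤ fugacityEntropy t s := by
  have h1 : 0 ≤ t * s ^ 2 := by positivity
  exact add_nonneg (Real.log_nonneg (by linarith))
    (mul_nonneg (by positivity) (Real.negMulLog_nonneg hs0 hs1))

/-- The trivial bound `∏ i, q i` with the AM–GM inequality, which is the entropy comparison at `s =
1`. -/
theorem log_card_le_mul_log_arithMean [∀ i, NeZero (q i)] (hn : 0 < n) (hq : ∀ i, 2 ≤ q i)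
    (C : Finset (MixedSpace q)) :
    Real.log C.card ≤ n * Real.log (arithMean q) := by
  have hm := two_le_arithMean hn hq
  have hone : ∀ t, fugacityEntropy t 1 = Real.log (1 + t) := fun t => by simp [fugacityEntropy]
  have h1 := sum_fugacityEntropy_le (fun i => (q i : ℝ) - 1) (fun i => by
    have : (2 : ℝ) ≤ q i := by exact_mod_cast hq i
    linarith) zero_le_one le_rfl (a := arithMean q - 1) (by linarith) (sum_sub_one_eq hn)
  simp only [hone, add_sub_cancel] at h1
  refine le_trans ?_ h1
  rcases C.eq_empty_or_nonempty with rfl | hC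
  · simp only [Finset.card_empty, Nat.cast_zero, Real.log_zero]
    exact Finset.sum_nonneg fun i _ => Real.log_natCast_nonneg _
  · rw [← Real.log_prod (fun i _ => by exact_mod_cast NeZero.ne (q i))]
    refine Real.log_le_log (by exact_mod_cast hC.card_pos) ?_
    have := Finset.card_le_univ C
    rw [Fintype.card_pi] at this
    simp only [ZMod.card] at this
    exact_mod_cast this

theorem sum_agree_le_of_hasMinDist [∀ i, NeZero (q i)] (hn : 0 < n) (hq : ∀ i, 2 ≤ q i)
    (hmono : Monotone q)
    {d : ℕ} (hd : d ≤ n) {C : Finset (MixedSpace q)} (hC : HasMinDist C d) :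
    ∀ x ∈ C, ∀ y ∈ C, x ≠ y → (∑ i, if x i = y i then (q i : ℝ) else 0) ≤
      n * (arithMean q * (1 - deltaCheck q d)) := by
  intro x hx y hy hxy
  have h1 := sum_filter_lt_le_sum_of_le_card hmono hd (Finset.univ.filter fun i => x i ≠ y i)
    (hC x hx y hy hxy)
  rw [← deltaCheck_mul hn hq] at h1
  have h2 := Finset.sum_filter_add_sum_filter_not Finset.univ (fun i => x i = y i)
    (fun i => (q i : ℝ))
  rw [sum_eq_mul_arithMean hn] at h2
  rw [← Finset.sum_filter]
  linarith

/-- The linear-programming bound with an error term given by the parameters `s`, `η`, `ε`. -/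
theorem log_card_le_of_fugacity [∀ i, NeZero (q i)] (hn : 0 < n) (hq : ∀ i, 2 ≤ q i)
    (hmono : Monotone q) {M : ℝ} (hM : ∀ i, (q i : ℝ) ≤ M) {d : ℕ} (hd : d ≤ n)
    {C : Finset (MixedSpace q)} (hC : HasMinDist C d) (hCne : C.Nonempty) {s η ε : ℝ}
    (hs0 : 0 ≤ s) (hη : 0 < η) (hsη : s + η ≤ 1) (hε0 : 0 ≤ ε) (hε : ε ≤ 2)
    (hs : arithMean q * (1 - deltaCheck q d) ≤ fugacityRayleigh (arithMean q - 1) s)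
    (hexp : 2 * (M / η) * Real.exp (-(n * ε ^ 2 / 4)) ≤ η ^ 2 / 4) :
    Real.log C.card ≤ n * fugacityEntropy (arithMean q - 1) (s + η) + 2 * ε * n * -Real.log η +
      Real.log (4 * M / η ^ 2) := by
  have hn' : (0 : ℝ) < n := by exact_mod_cast hn
  have hm := two_le_arithMean hn hq
  have hmM := arithMean_le hn hM
  have hδ0 := deltaCheck_nonneg hn hq d
  have hδ1 := deltaCheck_le_one hn hq d
  have ht : ∀ i, 0 ≤ (q i : ℝ) - 1 := fun i => by
    have : (2 : ℝ) ≤ q i := by exact_mod_cast hq i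
    linarith
  have hsη0 : 0 < s + η := by linarith
  set c₀ := n * (arithMean q * (1 - deltaCheck q d)) with hc₀
  have hc₀0 : 0 ≤ c₀ := mul_nonneg hn'.le (mul_nonneg (by linarith) (by linarith))
  have hsumM : ∑ i, (q i : ℝ) ≤ n * M := by
    rw [sum_eq_mul_arithMean hn]
    exact mul_le_mul_of_nonneg_left hmM hn'.le
  -- Half of this surplus pays for truncation (`herr`); the other half is the gap `c - c₀ = n * (η ^
  -- 2 / 4)`.
  have hray : c₀ + n * (η ^ 2 / 2) ≤ ∑ i, (1 + ((q i : ℝ) - 1) * (s + η)) ^ 2 /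
      (1 + ((q i : ℝ) - 1) * (s + η) ^ 2) := by
    refine le_trans ?_ (le_sum_fugacityRayleigh (fun i => (q i : ℝ) - 1) ht (s + η)
      (a := arithMean q - 1) (by linarith) (sum_sub_one_eq hn))
    rw [hc₀, ← mul_add]
    exact mul_le_mul_of_nonneg_left ((add_le_add_left hs _).trans
      (fugacityRayleigh_add_le (by linarith) hs0 hη.le hsη)) hn'.le
  have herr : 2 * ((∑ i, (q i : ℝ)) / (s + η)) * Real.exp (-(n * ε ^ 2 / 4)) ≤
      n * (η ^ 2 / 4) := by
    refine le_trans ?_ (mul_le_mul_of_nonneg_left hexp hn'.le)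
    rw [← mul_assoc]
    refine mul_le_mul_of_nonneg_right ?_ (Real.exp_pos _).le
    have : (∑ i, (q i : ℝ)) / (s + η) ≤ n * M / η :=
      div_le_div₀ (mul_nonneg hn'.le (by linarith)) hsumM hη (by linarith)
    calc _ ≤ 2 * (n * M / η) := by linarith
      _ = _ := by ring
  have key := card_mul_le_card_hammingBall_mul C hCne c₀ (c₀ + n * (η ^ 2 / 4))
    (le_add_of_nonneg_right (by positivity))
    (by
      rw [sum_eq_mul_arithMean hn, hc₀]
      exact mul_le_mul_of_nonneg_left (by nlinarith) hn'.le)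
    (by positivity) (sum_agree_le_of_hasMinDist hn hq hmono hd hC) (s + η) ε hsη0 hsη hε0 hε
    (by linarith)
  have hp : ∀ i, 0 ≤ ((q i : ℝ) - 1) * (s + η) ^ 2 := fun i => mul_nonneg (ht i) (sq_nonneg _)
  set W := (∑ i, ((q i : ℝ) - 1) * (s + η) ^ 2 / (1 + ((q i : ℝ) - 1) * (s + η) ^ 2)) + ε * n
    with hW
  have hW0 : 0 ≤ W := add_nonneg (Finset.sum_nonneg fun i _ =>
    div_nonneg (hp i) (by linarith [hp i])) (by positivity)
  have hball := log_card_hammingBall_le q (s + η) W hsη0 hsη hW0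
  set b : ℕ := (Finset.univ.filter fun x : MixedSpace q => (hammingNorm x : ℝ) ≤ W).card with hb
  have hCpos : (0 : ℝ) < C.card := by exact_mod_cast hCne.card_pos
  have hcard : (C.card : ℝ) ≤ b * (4 * M / η ^ 2) := by
    have h1 : (C.card : ℝ) * (n * (η ^ 2 / 4)) ≤ b * (n * M) := by
      rw [add_sub_cancel_left] at key
      exact key.trans (mul_le_mul_of_nonneg_left (by linarith) (Nat.cast_nonneg _))
    have h2 : (C.card : ℝ) * (n * (η ^ 2 / 4)) ≤ b * (4 * M / η ^ 2) * (n * (η ^ 2 / 4)) := by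
      refine h1.trans_eq ?_
      field_simp
    exact le_of_mul_le_mul_right h2 (by positivity)
  have hMpos : 0 < 4 * M / η ^ 2 := by
    have : 0 < M := by linarith
    positivity
  have hbpos : (0 : ℝ) < b := pos_of_mul_pos_left (hCpos.trans_le hcard) hMpos.le
  have hlog := Real.log_le_log hCpos hcard
  rw [Real.log_mul hbpos.ne' hMpos.ne'] at hlog
  have hent := sum_fugacityEntropy_le (fun i => (q i : ℝ) - 1) ht hsη0.le hsη
    (a := arithMean q - 1) (by linarith) (sum_sub_one_eq hn)
  -- The mean part of `W` completes the logarithms to entropies; the margin `ε * n` costs a multiple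
  -- of `-log (s + η)`, which the shift keeps below `-log η`.
  have hsplit : (∑ i, Real.log (1 + ((q i : ℝ) - 1) * (s + η) ^ 2)) +
      W * (2 * -Real.log (s + η)) = (∑ i, fugacityEntropy ((q i : ℝ) - 1) (s + η)) +
        2 * ε * n * -Real.log (s + η) := by
    rw [hW, add_mul, Finset.sum_mul, ← add_assoc, ← Finset.sum_add_distrib]
    congr 1
    · refine Finset.sum_congr rfl fun i _ => ?_
      simp only [fugacityEntropy, Real.negMulLog]
      ring
    · ring
  have hlogη : 2 * ε * n * -Real.log (s + η) ≤ 2 * ε * n * -Real.log η :=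
    mul_le_mul_of_nonneg_left (neg_le_neg (Real.log_le_log hη (by linarith))) (by positivity)
  linarith

/-- The linear-programming bound up to `ε * n`, for all long enough codes over bounded alphabets. -/
theorem eventually_log_card_le (M : ℝ) {ε : ℝ} (hε : 0 < ε) :
    ∀ᶠ n : ℕ in atTop, ∀ q : Fin n → ℕ, Monotone q → (∀ i, 2 ≤ q i) → (∀ i, (q i : ℝ) ≤ M) →
      ∀ d : ℕ, d ≤ n → ∀ C : Finset (MixedSpace q), HasMinDist C d →
        Real.log C.card ≤ n * Real.log (arithMean q) *
          mixedEntropy (arithMean q) (lpRadius q d / n) + ε * n := by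
  obtain ⟨η, hη0, hη1, hη⟩ := exists_forall_abs_fugacityEntropy_sub_le M (ε := ε / 3) (by positivity)
  set L := -Real.log η with hL
  have hL0 : 0 ≤ L := neg_nonneg.2 (Real.log_nonpos hη0.le hη1.le)
  -- The budget `ε * n` is split in three: the entropy change under the shift, the radius margin `κ
  -- * n`, and the constant `log (4 * M / η ^ 2)`.
  obtain ⟨κ, hκ0, hκ2, hκL⟩ : ∃ κ : ℝ, 0 < κ ∧ κ ≤ 2 ∧ 2 * κ * L ≤ ε / 3 := by
    refine ⟨min 2 (ε / (6 * (L + 1))), by positivity, min_le_left _ _, ?_⟩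
    have h1 : min 2 (ε / (6 * (L + 1))) * (6 * (L + 1)) ≤ ε := by
      rw [← le_div_iff₀ (by positivity)]
      exact min_le_right _ _
    have h2 : 0 < min 2 (ε / (6 * (L + 1))) := by positivity
    linarith
  have hlim : Tendsto (fun n : ℕ => 2 * (M / η) * Real.exp (-((n : ℝ) * κ ^ 2 / 4))) atTop
      (nhds 0) := by
    rw [← mul_zero (2 * (M / η))]
    refine Tendsto.const_mul _ (Real.tendsto_exp_neg_atTop_nhds_zero.comp ?_)
    exact (tendsto_natCast_atTop_atTop.atTop_mul_const (by positivity)).atTop_div_const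
      (by norm_num)
  have hlim2 : Tendsto (fun n : ℕ => ε / 3 * (n : ℝ)) atTop atTop :=
    tendsto_natCast_atTop_atTop.const_mul_atTop (by positivity)
  filter_upwards [hlim.eventually_le_const (u := η ^ 2 / 4) (by positivity),
    hlim2.eventually_ge_atTop (Real.log (4 * M / η ^ 2)), eventually_gt_atTop 0]
    with n hexp hlogM hn q hmono hq hqM d hd C hC
  have : ∀ i, NeZero (q i) := fun i => ⟨by have := hq i; omega⟩
  have hn' : (0 : ℝ) < n := by exact_mod_cast hn
  have hm := two_le_arithMean hn hq
  have hmM := arithMean_le hn hqM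
  obtain ⟨s, hs0, hs1, hray, hent⟩ := exists_fugacity_lpRadius hn hq d
  rw [mul_assoc]
  refine le_trans ?_ (add_le_add_left (mul_le_mul_of_nonneg_left hent hn'.le) _)
  have hent0 := fugacityEntropy_nonneg (t := arithMean q - 1) (by linarith) hs0 hs1
  rcases C.eq_empty_or_nonempty with rfl | hCne
  · simp only [Finset.card_empty, Nat.cast_zero, Real.log_zero]
    positivity
  by_cases hcase : s + η ≤ 1
  · have h1 := log_card_le_of_fugacity hn hq hmono hqM hd hC hCne hs0 hη0 hcase hκ0.le hκ2 hray hexp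
    have h2 := (abs_le.1 (hη (arithMean q - 1) (s + η) s (by linarith) (by linarith) (by linarith)
      hcase hs0 hs1 (by rw [add_sub_cancel_left, abs_of_pos hη0]))).2
    have h3 := mul_le_mul_of_nonneg_left h2 hn'.le
    have h4 := mul_le_mul_of_nonneg_right hκL hn'.le
    rw [← hL] at h1
    linarith
  -- Here `s` is within `η` of `1`, where the entropy is `log (arithMean q)`, so the trivial bound
  -- suffices.
  · have h1 := log_card_le_mul_log_arithMean hn hq C
    have h2 := (abs_le.1 (hη (arithMean q - 1) 1 s (by linarith) (by linarith) zero_le_one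
      le_rfl hs0 hs1 (by rw [abs_of_nonneg] <;> linarith))).2
    have hone : fugacityEntropy (arithMean q - 1) 1 = Real.log (arithMean q) := by
      simp [fugacityEntropy]
    rw [hone] at h2
    have h3 := mul_le_mul_of_nonneg_left h2 hn'.le
    have : 0 < ε * n := by positivity
    linarith

end MainBound

/-- First linear-programming bound for mixed codes. The error term depends only on the finite set
`S` from which the alphabet sizes are taken and on `n`. -/
theorem mainTheorem1 (S : Finset ℕ) (hS : ∀ s ∈ S, 1 < s) :
    ∃ e : ℕ → ℝ, e =o[atTop] (fun n : ℕ => (n : ℝ)) ∧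
      ∀ (n : ℕ) (q : Fin n → ℕ), 0 < n → Monotone q → (∀ i, q i ∈ S) →
        ∀ d : ℕ, d ≤ n → ∀ C : Finset (MixedSpace q), HasMinDist C d →
          Real.log (C.card : ℝ) ≤
            n * Real.log (arithMean q) * mixedEntropy (arithMean q) (lpRadius q d / n) + e n := by
  set M : ℝ := ((S.sup id : ℕ) : ℝ) with hM
  have hqM : ∀ s ∈ S, (s : ℝ) ≤ M := fun s hs =>
    Nat.cast_le.2 (Finset.le_sup (f := id) hs)
  -- The error `e n` is the supremum of these excesses, so it is uniform in `q`, `d` and `C`.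
  -- Adjoining `0` makes the set nonempty and `e n` nonnegative; the trivial bound makes it bounded.
  let A : ℕ → Set ℝ := fun n => {r | ∃ q : Fin n → ℕ, 0 < n ∧ Monotone q ∧ (∀ i, q i ∈ S) ∧
    ∃ d : ℕ, d ≤ n ∧ ∃ C : Finset (MixedSpace q), HasMinDist C d ∧
      r = Real.log C.card - n * Real.log (arithMean q) *
        mixedEntropy (arithMean q) (lpRadius q d / n)}
  have hbdd : ∀ n, BddAbove (insert 0 (A n)) := fun n => by
    refine BddAbove.insert 0 ⟨n * Real.log M, ?_⟩
    rintro r ⟨q, hn, -, hqS, d, -, C, -, rfl⟩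
    have hq : ∀ i, 2 ≤ q i := fun i => hS _ (hqS i)
    have : ∀ i, NeZero (q i) := fun i => ⟨by have := hq i; omega⟩
    have hn' : (0 : ℝ) < n := by exact_mod_cast hn
    have hm := two_le_arithMean hn hq
    obtain ⟨s, hs0, hs1, -, hent⟩ := exists_fugacity_lpRadius hn hq d
    have h0 := mul_nonneg hn'.le
      ((fugacityEntropy_nonneg (t := arithMean q - 1) (by linarith) hs0 hs1).trans hent)
    have h1 := log_card_le_mul_log_arithMean hn hq C
    have h2 := mul_le_mul_of_nonneg_left
      (Real.log_le_log (by linarith) (arithMean_le hn fun i => hqM _ (hqS i))) hn'.le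
    linarith
  refine ⟨fun n => sSup (insert 0 (A n)), ?_, fun n q hn hmono hqS d hd C hC => ?_⟩
  · rw [isLittleO_iff]
    intro ε hε
    filter_upwards [eventually_log_card_le M hε] with n hn
    rw [Real.norm_of_nonneg (le_csSup (hbdd n) (Set.mem_insert _ _)),
      Real.norm_of_nonneg (Nat.cast_nonneg n)]
    refine csSup_le (Set.insert_nonempty _ _) ?_
    rintro r (rfl | ⟨q, -, hmono, hqS, d, hd, C, hC, rfl⟩)
    · positivity
    · linarith [hn q hmono (fun i => hS _ (hqS i)) (fun i => hqM _ (hqS i)) d hd C hC]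
  · have := le_csSup (hbdd n) (Set.mem_insert_of_mem 0
      (show _ ∈ A n from ⟨q, hn, hmono, hqS, d, hd, C, hC, rfl⟩))
    linarith
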